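/- Let $L=(l_1,\dots,l_k)$ be positive integers with sum $n$, which are generic ($\sum_{i\in I}l_i=\sum_{j\in J}l_j$ with $I,J\subseteq[k]$ implies $I=J$) and reduced ($\gcd(l_1,\dots,l_k)=1$). Let $T=Tonn^{n,k}(L)$ be the simplicial complex on $\mathbb{Z}_n$ whose simplices are the nonempty subsets of the sets $\{x,\,x+l_{\sigma(1)},\,\dots,\,x+l_{\sigma(1)}+\dots+l_{\sigma(k-1)}\}$, $x\in\mathbb{Z}_n$, $\sigma\in\Sigma_k$. Fix $v_0\in\mathbb{Z}_n$. Universal cover. Edge-paths in $T$ with the same end-points are homotopic if they are related by a sequence of moves that replace two consecutive sides of a triangle of $T$ by the third side, or delete an edge followed by its inverse, and the reverses of these moves. The vertices of the simplicial universal cover $\widetilde T$ are the homotopy classes of edge-paths from $v_0$ to vertices of $T$; a nonempty finite set of them is a simplex if the end-points form a simplex of $T$ and any two different members are neighbours, where $\alpha$ (ending at $x$) and $\beta$ (ending at $y$) are neighbours if $e=\{x,y\}$ is an edge of $T$ and the loop $\alpha e\beta^{-1}$ is homotopically trivial. Lattice. Let $H_0=\{x\in\mathbb{R}^k: x_1+\dots+x_k=0\}$,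 let $\Lambda$ be the permutohedral lattice of all $x\in\mathbb{Z}^k\cap H_0$ whose coordinates are all congruent modulo $k$, and let $a_i\in\Lambda$ be the vector with $i$-th coordinate $k-1$ and all other coordinates $-1$. A Delone cell (of any dimension) is given by the nonempty set of all points of $\Lambda$ on the boundary sphere of a ball centred in $H_0$ with no point of $\Lambda$ in its interior; the simplices of $\mathcal{D}_\Lambda$ are the nonempty subsets of such sets. Cocycle. For an oriented edge $\overrightarrow{uv}$ of $T$ let $I\subseteq[k]$ be the unique set such that $\sum_{i\in I}l_i$ is the representative of $v-u$ in $\{0,\dots,n-1\}$. Put $\theta_{i,j}(\overrightarrow{uv})=\sum_{m\in I}(\delta_{m,i}-\delta_{m,j})$, $\omega_i=\sum_{j\ne i}\theta_{i,j}$, $\omega=(\omega_1,\dots,\omega_k)$, and let $\omega(\alpha)$ be the sum of the values of $\omega$ on the edges of an edge-path $\alpha$. Let $E_1^{p_1}\cdots E_k^{p_k}$ ($p_i\ge 0$) denote the edge-path from $v_0$ that consists of $p_1$ edges $x\to x+l_1$, followed by $p_2$ edges $x\to x+l_2$, and so on. Then: 1. If $k\ge2$, the edge-path $E_1^{p_1}\cdots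 E_k^{p_k}$ exists in $T$ for all $p_1,\dots,p_k\ge0$. (For $k=1$ there are no edges and only $p=0$ occurs.) For every $k$, each edge-path from $v_0$ is homotopic to one of this form. 2. Each simplex of $\mathcal{D}_\Lambda$ is itself the vertex set of a Delone cell. 3. The discrete Abel–Jacobi map $\Omega$, $\Omega([\alpha])=\omega(\alpha)$, is well defined from the vertices of $\widetilde T$ to $\Lambda$, and $\Omega([E_1^{p_1}\cdots E_k^{p_k}])=\sum_{i=1}^k p_i a_i$. 4. $\Omega:\widetilde T\to\mathcal{D}_\Lambda$ is an isomorphism of simplicial complexes: it is a bijection on vertices, and a finite set of vertices is a simplex of $\widetilde T$ if and only if its image is a simplex of $\mathcal{D}_\Lambda$. -/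

import Mathlib

namespace Tonnetz

/-! ### Edge-paths and the simplicial universal cover -/

section Cover

variable {V : Type*} [DecidableEq V]

/-- The graph of vertices and edges (1-simplices) of a simplicial complex. -/
def edgeGraph (K : PreAbstractSimplicialComplex V) : SimpleGraph V where
  Adj u v := u ≠ v ∧ ({u, v} : Finset V) ∈ K.faces
  symm := ⟨fun u v h => ⟨h.1.symm, by rw [Finset.pair_comm]; exact h.2⟩⟩
  loopless := ⟨fun _ h => h.1 rfl⟩

/-- An edge-path from `a` to `b`: a sequence of consecutive oriented edges of `K`. -/
abbrev EdgePath (K : PreAbstractSimplicialComplex V) (a b : V) : Type _ :=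
  (edgeGraph K).Walk a b

/-- Elementary moves of combinatorial homotopy: two consecutive sides of a triangle of `K` are
replaced by the third side, or an edge followed by its inverse is deleted. -/
inductive ElementaryMove (K : PreAbstractSimplicialComplex V) {a b : V} :
    EdgePath K a b → EdgePath K a b → Prop
  | triangle {x y z : V} (α : EdgePath K a x) (hxy : (edgeGraph K).Adj x y)
      (hyz : (edgeGraph K).Adj y z) (hxz : (edgeGraph K).Adj x z)
      (ht : ({x, y, z} : Finset V) ∈ K.faces) (β : EdgePath K z b) :
      ElementaryMove K (α.append (.cons hxy (.cons hyz β))) (α.append (.cons hxz β))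
  | backtrack {x y : V} (α : EdgePath K a x) (hxy : (edgeGraph K).Adj x y)
      (β : EdgePath K x b) :
      ElementaryMove K (α.append (.cons hxy (.cons hxy.symm β))) (α.append β)

/-- Combinatorial homotopy (relative to the end-points): the equivalence relation generated by
the elementary moves. -/
def homotopySetoid (K : PreAbstractSimplicialComplex V) (a b : V) : Setoid (EdgePath K a b) :=
  Relation.EqvGen.setoid (ElementaryMove K)

/-- Two edge-paths with the same end-points are homotopic. -/
def Homotopic {K : PreAbstractSimplicialComplex V} {a b : V} (α β : EdgePath K a b) : Prop :=
  homotopySetoid K a b α β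

/-- Vertices of the universal cover based at `v₀`: pairs of a vertex `x` and a homotopy class of
edge-paths from `v₀` to `x`. -/
def CoverVertex (K : PreAbstractSimplicialComplex V) (v₀ : V) : Type _ :=
  Σ x : V, Quotient (homotopySetoid K v₀ x)

/-- The vertex of the universal cover given by an edge-path. -/
def CoverVertex.mk {K : PreAbstractSimplicialComplex V} {v₀ x : V} (α : EdgePath K v₀ x) :
    CoverVertex K v₀ :=
  ⟨x, Quotient.mk (homotopySetoid K v₀ x) α⟩

/-- The end-point of (any edge-path representing) a vertex of the universal cover. -/
def CoverVertex.endpoint {K : PreAbstractSimplicialComplex V} {v₀ : V}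
    (v : CoverVertex K v₀) : V :=
  v.1

/-- Two edge-paths `α`, `β` from `v₀` with end-points `x`, `y` are neighbours if `{x, y}` is an
edge `e` and the loop `α e β⁻¹` is homotopically trivial. -/
def Neighbors {K : PreAbstractSimplicialComplex V} {v₀ x y : V}
    (α : EdgePath K v₀ x) (β : EdgePath K v₀ y) : Prop :=
  ∃ e : (edgeGraph K).Adj x y, Homotopic ((α.concat e).append β.reverse) .nil

/-- Neighbouring vertices of the universal cover. -/
def CoverVertex.Neighbors {K : PreAbstractSimplicialComplex V} {v₀ : V}
    (v w : CoverVertex K v₀) : Prop :=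
  ∃ (x y : V) (α : EdgePath K v₀ x) (β : EdgePath K v₀ y),
    CoverVertex.mk α = v ∧ CoverVertex.mk β = w ∧ Tonnetz.Neighbors α β

/-- The simplicial universal cover of `K` (based at `v₀`): a simplex is a nonempty finite set of
pairwise neighbouring vertices whose end-points form a simplex of `K`. -/
def universalCover (K : PreAbstractSimplicialComplex V) (v₀ : V) :
    PreAbstractSimplicialComplex (CoverVertex K v₀) where
  faces := {s | s.Nonempty ∧ s.image CoverVertex.endpoint ∈ K.faces ∧
    ∀ v ∈ s, ∀ w ∈ s, v ≠ w → v.Neighbors w}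
  isRelLowerSet_faces := by
    rintro s ⟨hs, himg, hnb⟩
    refine ⟨hs, fun t hts ht => ⟨ht, ?_, fun v hv w hw => hnb v (hts hv) w (hts hw)⟩⟩
    exact (K.isRelLowerSet_faces himg).2 (Finset.image_subset_image hts) (ht.image _)

end Cover

/-- `f` is an isomorphism of simplicial complexes from `K` to `M` (the vertex sets being all of
`V` and all of `W`): a bijection on vertices such that a finite set of vertices is a simplex of
`K` if and only if its image is a simplex of `M`. -/
def IsSimplicialIso {V W : Type*} [DecidableEq W] (K : PreAbstractSimplicialComplex V)
    (M : PreAbstractSimplicialComplex W) (f : V → W) : Prop :=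
  Function.Bijective f ∧ ∀ s : Finset V, s ∈ K.faces ↔ s.image f ∈ M.faces

/-! ### The generalized Tonnetz -/

/-- A collection `l₁, …, l_k` of positive integers with sum `n`. -/
structure LengthVector (n k : ℕ) where
  /-- the entries -/
  len : Fin k → ℕ
  len_pos : ∀ i, 0 < len i
  sum_len : ∑ i, len i = n

namespace LengthVector

variable {n k : ℕ}

/-- Different sets of indices have different sums. -/
def Generic (L : LengthVector n k) : Prop :=
  ∀ I J : Finset (Fin k), ∑ i ∈ I, L.len i = ∑ j ∈ J, L.len j → I = J

/-- The greatest common divisor of the entries is one. -/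
def Reduced (L : LengthVector n k) : Prop :=
  Finset.univ.gcd L.len = 1

/-- The set `{x, x + l_{σ(1)}, …, x + l_{σ(1)} + ⋯ + l_{σ(k-1)}}` in `ℤ/n`. -/
def maxSimplex (L : LengthVector n k) (x : ZMod n) (σ : Equiv.Perm (Fin k)) :
    Finset (ZMod n) :=
  Finset.univ.image fun j : Fin k => x + ∑ i ∈ Finset.Iio j, (L.len (σ i) : ZMod n)

/-- The generalized Tonnetz: all nonempty subsets of the maximal simplices. -/
def tonnetz (L : LengthVector n k) : PreAbstractSimplicialComplex (ZMod n) where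
  faces := {s | s.Nonempty ∧ ∃ x σ, s ⊆ L.maxSimplex x σ}
  isRelLowerSet_faces := by
    rintro s ⟨hs, x, σ, h⟩
    exact ⟨hs, fun t hts ht => ⟨ht, x, σ, hts.trans h⟩⟩

/-! ### The canonical cocycle -/

open Classical in
/-- The type of the oriented edge `uv`: the set `I` of indices with `∑_{i ∈ I} l_i` equal to the
length `v - u ∈ {0, …, n - 1}` of the interval from `u` to `v` (unique if `L` is generic). -/
noncomputable def edgeType (L : LengthVector n k) (u v : ZMod n) : Finset (Fin k) :=
  if h : ∃ I : Finset (Fin k), ∑ i ∈ I, L.len i = (v - u).val then h.choose else ∅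

/-- The elementary cocycle `θ_{i,j}`. An oriented edge of type `I` is homotopic to a product of
positive atomic edges, one of each type `m ∈ I`; such an edge has value `1` for `m = i`, value
`-1` for `m = j`, and `0` otherwise. -/
noncomputable def theta (L : LengthVector n k) (i j : Fin k) (u v : ZMod n) : ℤ :=
  ∑ m ∈ L.edgeType u v, ((if m = i then 1 else 0) - (if m = j then 1 else 0))

/-- The vector-valued canonical cocycle `ω = (ω₁, …, ω_k)`, `ω_i = ∑_{j ≠ i} θ_{i,j}`, on an
oriented edge. -/
noncomputable def omegaEdge (L : LengthVector n k) (u v : ZMod n) : Fin k → ℤ :=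
  fun i => ∑ j ∈ Finset.univ.erase i, L.theta i j u v

/-- The value of `ω` on an edge-path: the sum of its values on the edges of the path. -/
noncomputable def omega (L : LengthVector n k) {a b : ZMod n} (α : EdgePath L.tonnetz a b) :
    Fin k → ℤ :=
  (α.darts.map fun d => L.omegaEdge d.fst d.snd).sum

/-- `α` is the edge-path `E₁^{p₁} E₂^{p₂} ⋯ E_k^{p_k}` starting at `a`: `p₁` edges of the form
`x → x + l₁` are followed by `p₂` edges of the form `x → x + l₂`, and so on. -/
def IsMonomialPath (L : LengthVector n k) (p : Fin k → ℕ) {a b : ZMod n}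
    (α : EdgePath L.tonnetz a b) : Prop :=
  α.support = List.scanl (fun x i => x + (L.len i : ZMod n)) a
    ((List.finRange k).flatMap fun i => List.replicate (p i) i)

end LengthVector

/-! ### The permutohedral lattice and its Delone triangulation -/

/-- The permutohedral lattice `Λ` (of type `A*_{k-1}`): integer vectors with coordinate sum zero
all of whose coordinates are congruent modulo `k`. -/
def permLattice (k : ℕ) : AddSubgroup (Fin k → ℤ) where
  carrier := {x | ∑ i, x i = 0 ∧ ∀ i j, x i ≡ x j [ZMOD k]}
  zero_mem' := by simp
  add_mem' := by
    rintro x y ⟨hx, hx'⟩ ⟨hy, hy'⟩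
    refine ⟨by simp [Finset.sum_add_distrib, hx, hy], fun i j => ?_⟩
    exact (hx' i j).add (hy' i j)
  neg_mem' := by
    rintro x ⟨hx, hx'⟩
    exact ⟨by simp [hx], fun i j => (hx' i j).neg⟩

/-- The vector `a_i`, with `i`-th coordinate `k - 1` and all other coordinates `-1`. -/
def latticeVector (k : ℕ) (i : Fin k) : Fin k → ℤ :=
  fun j => if j = i then (k : ℤ) - 1 else -1

/-- The hyperplane `H₀ = {x ∈ ℝᵏ | x₁ + ⋯ + x_k = 0}`. -/
def hyperplane (k : ℕ) : Set (EuclideanSpace ℝ (Fin k)) :=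
  {x | ∑ i, x i = 0}

/-- An element of `Λ` as a point of Euclidean space. -/
noncomputable def latticePoint {k : ℕ} (z : permLattice k) : EuclideanSpace ℝ (Fin k) :=
  WithLp.toLp 2 fun i => ((z : Fin k → ℤ) i : ℝ)

/-- `s` is (the vertex set of) a cell, of any dimension, of the Delone decomposition of `H₀`: the
nonempty set of all points of `Λ` on the boundary sphere of a ball, centred in `H₀`, without
points of `Λ` in its interior. -/
def IsDeloneCell {k : ℕ} (s : Finset (permLattice k)) : Prop :=
  s.Nonempty ∧ ∃ c ∈ hyperplane k, ∃ r : ℝ, (∀ z, r ≤ dist (latticePoint z) c) ∧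
    ∀ z, z ∈ s ↔ dist (latticePoint z) c = r

/-- The Delone complex `𝒟_Λ`: its simplices are the nonempty subsets of Delone cells. -/
def deloneComplex (k : ℕ) : PreAbstractSimplicialComplex (permLattice k) where
  faces := {t | t.Nonempty ∧ ∃ s, IsDeloneCell s ∧ t ⊆ s}
  isRelLowerSet_faces := by
    rintro s ⟨hs, c, hc, h⟩
    exact ⟨hs, fun t hts ht => ⟨ht, c, hc, hts.trans h⟩⟩

end Tonnetz

/-!
Both complexes are identified with the complex of nonempty cliques of the lattice `Λ`, where two
points are joined if they differ by `a_I = ∑_{i ∈ I} a_i` for a proper subset `I` of `[k]`.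

*Lattice side.* Write `Λ = ℤᵏ / ℤ(1, …, 1)`, with `a_i` the image of the `i`-th basis vector
(`latticeMap`). The squared distance to a point of `H₀`, pulled back to `ℤᵏ`, is strictly
submodular on incomparable vectors (`energy_inf_add_sup_lt`), so the lifts of the points of a Delone
cell form a chain that is stable under adding `(1, …, 1)`. Hence any two points of the cell differ
by some `a_I` (`IsDeloneCell.isLatticeClique`). Conversely, seen from one of its members `z`, a
clique is `{z + a_A : A ∈ C}` for a chain `C` of proper subsets with `∅ ∈ C`. Rank each index by the
number of members of `C` that miss it. For a suitable centre, the squared distance from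
`z + ∑ d_i a_i` is, up to constants, the sum over all pairs of `(d_i - d_j)² - s_ij (d_i - d_j)`
with `s_ij ∈ {-1, 0, 1}` the sign of the difference of ranks. All terms are nonnegative, and they
vanish simultaneously exactly on the clique (`IsLatticeClique.mem_iff_pairEnergy`). So each nonempty
clique is itself a Delone cell (`IsLatticeClique.isDeloneCell`).

*Tonnetz side.* The simplices of `T` are the sets of points `x + l_A` with `A` in a chain of proper
subsets of `[k]` (`LengthVector.mem_tonnetz_iff`). On such a simplex the cocycle is the coboundary
of `A ↦ a_A`, because `∑ a_i = 0`, so it is invariant under homotopy and induces a map `Ω` on the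
universal cover. Appending an edge of type `{i}` is an operation on the vertices of the universal
cover. By the triangles of `T` these operations commute, the product over `i ∈ I` appends an edge of
type `I`, and the product over all `i` is trivial (`LengthVector.advance_advance`). Hence every
vertex is reached from the base point by a monomial word in these operations and depends only on
the lattice vector of the word, which makes `Ω` bijective. Neighbours correspond to differences
`a_I`, so the simplices of the universal cover correspond to the nonempty cliques.
-/

namespace Tonnetz

/-! ### The permutohedral lattice as a quotient of `ℤᵏ` -/

/-- The homomorphism `ℤᵏ → Λ` sending the `i`-th standard basis vector to `a_i`. It is onto, and
its kernel consists of the constant vectors. -/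
def latticeMap (k : ℕ) : (Fin k → ℤ) →+ permLattice k where
  toFun q := ⟨fun i => k * q i - ∑ j, q j, by
    refine ⟨by simp [Finset.sum_sub_distrib, Finset.mul_sum], fun i j => ?_⟩
    exact (Int.modEq_iff_dvd).2 ⟨q j - q i, by ring⟩⟩
  map_zero' := by ext i; simp
  map_add' p q := by
    ext i
    simp only [Pi.add_apply, Finset.sum_add_distrib, AddSubgroup.coe_add]
    ring

@[simp] lemma latticeMap_apply {k : ℕ} (q : Fin k → ℤ) (i : Fin k) :
    (latticeMap k q : Fin k → ℤ) i = k * q i - ∑ j, q j := rfl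

lemma latticeMap_surjective {k : ℕ} (hk : k ≠ 0) : Function.Surjective (latticeMap k) := by
  rintro ⟨z, hz, hmod⟩
  let i₀ : Fin k := ⟨0, Nat.pos_of_ne_zero hk⟩
  have hk' : (k : ℤ) ≠ 0 := by exact_mod_cast hk
  choose q hq using fun i => (Int.modEq_iff_dvd).1 (hmod i₀ i)
  have hz' : ∀ i, z i = z i₀ + k * q i := fun i => by linarith [hq i]
  have hsum : z i₀ = -∑ i, q i := by
    have h : ∑ i, z i = k * (z i₀ + ∑ i, q i) := by
      rw [Finset.sum_congr rfl fun i _ => hz' i]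
      simp [Finset.sum_add_distrib, Finset.mul_sum, mul_add]
    rw [hz] at h
    rcases mul_eq_zero.1 h.symm with h | h
    · exact absurd h hk'
    · linarith
  refine ⟨q, ?_⟩
  ext i
  change k * q i - ∑ j, q j = z i
  rw [hz' i, hsum]
  ring

lemma latticeMap_const {k : ℕ} (t : ℤ) : latticeMap k (fun _ => t) = 0 := by
  ext i
  simp

lemma latticeMap_eq_iff {k : ℕ} (p q : Fin k → ℤ) :
    latticeMap k p = latticeMap k q ↔ ∃ t : ℤ, ∀ i, p i = q i + t := by
  constructor
  · intro h
    rcases Nat.eq_zero_or_pos k with rfl | hk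
    · exact ⟨0, fun i => i.elim0⟩
    refine ⟨p ⟨0, hk⟩ - q ⟨0, hk⟩, fun i => ?_⟩
    have hval : ∀ i, (k : ℤ) * p i - ∑ j, p j = k * q i - ∑ j, q j := fun i => by
      rw [← latticeMap_apply, ← latticeMap_apply, h]
    have hk' : (k : ℤ) ≠ 0 := by exact_mod_cast hk.ne'
    apply mul_left_cancel₀ hk'
    linarith [hval i, hval ⟨0, hk⟩]
  · rintro ⟨t, ht⟩
    have : p = q + fun _ => t := funext ht
    rw [this, map_add, latticeMap_const, add_zero]

/-- The indicator vector of a set of indices. -/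
def indicatorVec {k : ℕ} (I : Finset (Fin k)) : Fin k → ℤ := fun i => if i ∈ I then 1 else 0

/-- The lattice vector `a_I = ∑_{i ∈ I} a_i`. -/
def subsetVec {k : ℕ} (I : Finset (Fin k)) : permLattice k := latticeMap k (indicatorVec I)

@[simp] lemma subsetVec_empty {k : ℕ} : subsetVec (∅ : Finset (Fin k)) = 0 := by
  have : indicatorVec (∅ : Finset (Fin k)) = 0 := by ext; simp [indicatorVec]
  rw [subsetVec, this, map_zero]

@[simp] lemma subsetVec_univ {k : ℕ} : subsetVec (Finset.univ : Finset (Fin k)) = 0 := by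
  have : indicatorVec (Finset.univ : Finset (Fin k)) = fun _ => 1 := by ext; simp [indicatorVec]
  rw [subsetVec, this, latticeMap_const]

lemma subsetVec_union {k : ℕ} {I J : Finset (Fin k)} (h : Disjoint I J) :
    subsetVec (I ∪ J) = subsetVec I + subsetVec J := by
  rw [subsetVec, subsetVec, subsetVec, ← map_add]
  congr 1
  ext i
  have hi : i ∈ I → i ∉ J := fun hi => Finset.disjoint_left.1 h hi
  by_cases h1 : i ∈ I <;> by_cases h2 : i ∈ J <;> simp_all [indicatorVec]

lemma latticeVector_eq_ite_sub_one {k : ℕ} (i j : Fin k) :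
    latticeVector k i j = (if j = i then (k : ℤ) else 0) - 1 := by
  unfold latticeVector
  split_ifs <;> simp

lemma coe_subsetVec {k : ℕ} (I : Finset (Fin k)) :
    (subsetVec I : Fin k → ℤ) = ∑ i ∈ I, latticeVector k i := by
  ext j
  simp only [subsetVec, latticeMap_apply, indicatorVec, Finset.sum_apply,
    latticeVector_eq_ite_sub_one, Finset.sum_sub_distrib, Finset.sum_ite_eq]
  simp

lemma coe_latticeMap {k : ℕ} (q : Fin k → ℤ) :
    (latticeMap k q : Fin k → ℤ) = ∑ i, q i • latticeVector k i := by
  ext j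
  simp [latticeVector_eq_ite_sub_one, mul_sub, Finset.sum_sub_distrib, mul_comm]

/-! ### Cliques of the lattice -/

/-- Any two members differ by a vector `a_A` with `A` a proper subset of `[k]`, where `A = ∅`
accounts for equal members. -/
def IsLatticeClique {k : ℕ} (t : Finset (permLattice k)) : Prop :=
  ∀ u ∈ t, ∀ w ∈ t, ∃ A : Finset (Fin k), A ≠ Finset.univ ∧ w = u + subsetVec A

/-- If `a_B - a_A = a_D` with `B` and `D` proper, then `A` and `B` are comparable: the indicator
vectors satisfy `1_B = 1_A + 1_D + t` for a constant `t`, which is `0` or `-1`. -/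
lemma subset_or_subset_of_subsetVec {k : ℕ} {A B D : Finset (Fin k)} (hB : B ≠ Finset.univ)
    (hD : D ≠ Finset.univ) (h : subsetVec B = subsetVec A + subsetVec D) : A ⊆ B ∨ B ⊆ A := by
  rw [subsetVec, subsetVec, subsetVec, ← map_add, latticeMap_eq_iff] at h
  obtain ⟨t, ht⟩ := h
  simp only [indicatorVec, Pi.add_apply] at ht
  obtain ⟨i, hi⟩ : ∃ i, i ∉ D := by simpa [Finset.eq_univ_iff_forall] using hD
  obtain ⟨j, hj⟩ : ∃ j, j ∉ B := by simpa [Finset.eq_univ_iff_forall] using hB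
  have h1 := ht i
  have h2 := ht j
  have ht0 : t ≤ 0 := by
    rw [if_neg hj] at h2
    split_ifs at h2 <;> omega
  have ht1 : -1 ≤ t := by
    rw [if_neg hi] at h1
    split_ifs at h1 <;> omega
  rcases (show t = 0 ∨ t = -1 by omega) with rfl | rfl
  · left
    intro m hm
    have := ht m
    by_contra hmB
    rw [if_neg hmB, if_pos hm] at this
    split_ifs at this <;> omega
  · right
    intro m hm
    have := ht m
    by_contra hmA
    rw [if_pos hm, if_neg hmA] at this
    split_ifs at this <;> omega

open Classical in
/-- The proper subsets `A` of `[k]` for which `z + a_A` belongs to `t`. -/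
noncomputable def linkSets {k : ℕ} (t : Finset (permLattice k)) (z : permLattice k) :
    Finset (Finset (Fin k)) :=
  Finset.univ.filter fun A => A ≠ Finset.univ ∧ z + subsetVec A ∈ t

lemma mem_linkSets {k : ℕ} {t : Finset (permLattice k)} {z : permLattice k}
    {A : Finset (Fin k)} :
    A ∈ linkSets t z ↔ A ≠ Finset.univ ∧ z + subsetVec A ∈ t := by
  simp [linkSets]

/-- A family of sets any two of which are comparable. -/
def IsSetChain {k : ℕ} (C : Finset (Finset (Fin k))) : Prop :=
  ∀ A ∈ C, ∀ B ∈ C, A ⊆ B ∨ B ⊆ A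

lemma IsLatticeClique.isSetChain {k : ℕ} {t : Finset (permLattice k)} (ht : IsLatticeClique t)
    (z : permLattice k) : IsSetChain (linkSets t z) := by
  intro A hA B hB
  rw [mem_linkSets] at hA hB
  obtain ⟨D, hD, h⟩ := ht _ hA.2 _ hB.2
  rw [add_assoc] at h
  exact subset_or_subset_of_subsetVec hB.1 hD (add_left_cancel h)

/-- The rank of an index in a family of sets: the number of members that miss it. The members of a
chain are lower sets for the rank. -/
def chainRank {k : ℕ} (C : Finset (Finset (Fin k))) (i : Fin k) : ℕ :=
  (C.filter fun A => i ∉ A).card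

lemma IsSetChain.chainRank_lt {k : ℕ} {C : Finset (Finset (Fin k))} (hC : IsSetChain C)
    {A : Finset (Fin k)} (hA : A ∈ C) {i j : Fin k} (hi : i ∈ A) (hj : j ∉ A) :
    chainRank C i < chainRank C j := by
  apply Finset.card_lt_card
  rw [Finset.ssubset_iff_of_subset]
  · exact ⟨A, by simp [hA, hj], by simp [hi]⟩
  · intro B hB
    rw [Finset.mem_filter] at hB ⊢
    refine ⟨hB.1, fun hjB => ?_⟩
    rcases hC A hA B hB.1 with h | h
    · exact hB.2 (h hi)
    · exact hj (h hjB)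

/-- A proper lower set for the rank of a chain that contains `∅` is a member of the chain. -/
lemma IsSetChain.mem_of_lower {k : ℕ} {C : Finset (Finset (Fin k))} (hC : IsSetChain C)
    (h0 : ∅ ∈ C) {A : Finset (Fin k)} (hA : A ≠ Finset.univ)
    (hlow : ∀ i ∈ A, ∀ j ∉ A, chainRank C i < chainRank C j) : A ∈ C := by
  obtain ⟨j₁, hj₁⟩ : ∃ i, i ∉ A := by simpa [Finset.eq_univ_iff_forall] using hA
  obtain ⟨j, hj, hmin⟩ := Finset.exists_min_image Aᶜ (chainRank C) ⟨j₁, by simpa using hj₁⟩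
  rw [Finset.mem_compl] at hj
  -- `A` is the largest member of the chain that misses `j`.
  obtain ⟨B, hB, hmax⟩ := Finset.exists_max_image (C.filter fun B => j ∉ B) Finset.card
    ⟨∅, by simp [h0]⟩
  rw [Finset.mem_filter] at hB
  have hle : ∀ B' ∈ C, j ∉ B' → B' ⊆ B := by
    intro B' hB' hjB'
    rcases hC B' hB' B hB.1 with h | h
    · exact h
    · exact (Finset.eq_of_subset_of_card_le h (hmax B' (by simp [hB', hjB']))).symm.subset
  have : A = B := by
    apply Finset.Subset.antisymm
    · intro i hi
      have hlt := hlow i hi j hj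
      by_contra hiB
      refine absurd hlt (not_lt.2 (Finset.card_le_card fun B' hB' => ?_))
      rw [Finset.mem_filter] at hB' ⊢
      exact ⟨hB'.1, fun h => hiB (hle B' hB'.1 hB'.2 h)⟩
    · intro i hi
      by_contra hiA
      exact absurd (hmin i (by simpa using hiA)) (not_le.2 (hC.chainRank_lt hB.1 hi hB.2))
  exact this ▸ hB.1

/-! ### Delone cells -/

/-- The part of the squared distance from the lattice point of `q` to the centre `c` that depends
on `q`, up to the factor `k`. -/
noncomputable def energy {k : ℕ} (c : Fin k → ℝ) (q : Fin k → ℤ) : ℝ :=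
  k * ∑ i, (q i : ℝ) ^ 2 - (∑ i, (q i : ℝ)) ^ 2 - 2 * ∑ i, (q i : ℝ) * c i

lemma dist_sq_latticeMap {k : ℕ} {c : EuclideanSpace ℝ (Fin k)} (hc : c ∈ hyperplane k)
    (q : Fin k → ℤ) :
    dist (latticePoint (latticeMap k q)) c ^ 2 = k * energy c.ofLp q + ∑ i, c i ^ 2 := by
  have hc' : ∑ i, c i = 0 := hc
  rw [EuclideanSpace.dist_eq, Real.sq_sqrt (Finset.sum_nonneg fun i _ => sq_nonneg _)]
  simp only [latticePoint, latticeMap_apply, Real.dist_eq, sq_abs]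
  push_cast
  set S := ∑ j, (q j : ℝ) with hS
  have h : ∀ i, ((k : ℝ) * q i - S - c i) ^ 2 =
      k ^ 2 * (q i : ℝ) ^ 2 - 2 * k * S * q i + S ^ 2 - 2 * k * (q i * c i) + 2 * S * c i
        + c i ^ 2 := fun i => by ring
  simp only [h, Finset.sum_add_distrib, Finset.sum_sub_distrib, ← Finset.mul_sum, ← hS, hc']
  simp only [energy, ← hS, Finset.sum_const, Finset.card_univ, Fintype.card_fin, nsmul_eq_mul]
  ring

/-- The energy is submodular on `ℤᵏ`, strictly so for incomparable vectors. -/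
lemma energy_inf_add_sup_lt {k : ℕ} (c : Fin k → ℝ) {p q : Fin k → ℤ} (hpq : ¬ p ≤ q)
    (hqp : ¬ q ≤ p) : energy c (p ⊓ q) + energy c (p ⊔ q) < energy c p + energy c q := by
  obtain ⟨i, hi⟩ : ∃ i, q i < p i := by simpa [Pi.le_def] using hpq
  obtain ⟨j, hj⟩ : ∃ i, p i < q i := by simpa [Pi.le_def] using hqp
  have hmm : ∀ m, (((p ⊓ q) m : ℤ) : ℝ) + (((p ⊔ q) m : ℤ) : ℝ) = p m + q m := fun m => by
    have := min_add_max (p m) (q m)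
    simp only [Pi.inf_apply, Pi.sup_apply]
    exact_mod_cast this
  have hsq : ∀ m, (((p ⊓ q) m : ℤ) : ℝ) ^ 2 + (((p ⊔ q) m : ℤ) : ℝ) ^ 2
      = (p m : ℝ) ^ 2 + (q m : ℝ) ^ 2 := fun m => by
    simp only [Pi.inf_apply, Pi.sup_apply]
    rcases le_total (p m) (q m) with h | h
    · simp [h]
    · simp [h, add_comm]
  have h1 : ∑ m, (((p ⊓ q) m : ℤ) : ℝ) + ∑ m, (((p ⊔ q) m : ℤ) : ℝ)
      = ∑ m, (p m : ℝ) + ∑ m, (q m : ℝ) := by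
    simp only [← Finset.sum_add_distrib, hmm]
  have h2 : ∑ m, (((p ⊓ q) m : ℤ) : ℝ) ^ 2 + ∑ m, (((p ⊔ q) m : ℤ) : ℝ) ^ 2
      = ∑ m, (p m : ℝ) ^ 2 + ∑ m, (q m : ℝ) ^ 2 := by
    simp only [← Finset.sum_add_distrib, hsq]
  have h3 : ∑ m, (((p ⊓ q) m : ℤ) : ℝ) * c m + ∑ m, (((p ⊔ q) m : ℤ) : ℝ) * c m
      = ∑ m, (p m : ℝ) * c m + ∑ m, (q m : ℝ) * c m := by
    simp only [← Finset.sum_add_distrib, ← add_mul, hmm]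
  have hlt1 : ∑ m, (((p ⊓ q) m : ℤ) : ℝ) < ∑ m, (p m : ℝ) :=
    Finset.sum_lt_sum (fun m _ => by exact_mod_cast inf_le_left (a := p) (b := q) m)
      ⟨i, Finset.mem_univ _, by simpa using hi⟩
  have hlt2 : ∑ m, (p m : ℝ) < ∑ m, (((p ⊔ q) m : ℤ) : ℝ) :=
    Finset.sum_lt_sum (fun m _ => by exact_mod_cast le_sup_left (a := p) (b := q) m)
      ⟨j, Finset.mem_univ _, by simpa using hj⟩
  simp only [energy]
  -- With equal sums, the defect of submodularity is `2 (S_p - S_inf) (S_sup - S_p)`.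
  have hq : ∑ m, (q m : ℝ) = ∑ m, (((p ⊓ q) m : ℤ) : ℝ) + ∑ m, (((p ⊔ q) m : ℤ) : ℝ)
      - ∑ m, (p m : ℝ) := by linarith
  have h2' := congrArg (fun x => (k : ℝ) * x) h2
  simp only [mul_add] at h2'
  rw [hq]
  nlinarith [mul_pos (sub_pos.2 hlt1) (sub_pos.2 hlt2)]

/-- Two nearest lattice points of an empty ball differ by some `a_A`: by strict submodularity, all
their lifts to `ℤᵏ` are comparable. -/
lemma IsDeloneCell.isLatticeClique {k : ℕ} (hk : k ≠ 0) {s : Finset (permLattice k)}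
    (hs : IsDeloneCell s) : IsLatticeClique s := by
  obtain ⟨-, c, hc, r, hr, hmem⟩ := hs
  have hr0 : ∀ z ∈ s, 0 ≤ r := fun z hz => (hmem z).1 hz ▸ dist_nonneg
  have hkpos : (0 : ℝ) < k := by exact_mod_cast Nat.pos_of_ne_zero hk
  have hmin : ∀ p q : Fin k → ℤ, latticeMap k p ∈ s → energy c.ofLp p ≤ energy c.ofLp q := by
    intro p q hp
    have h1 := dist_sq_latticeMap hc p
    have h2 := dist_sq_latticeMap hc q
    rw [(hmem _).1 hp] at h1
    have h3 := pow_le_pow_left₀ (hr0 _ hp) (hr (latticeMap k q)) 2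
    exact le_of_mul_le_mul_left (by linarith) hkpos
  have hcomp : ∀ p q : Fin k → ℤ, latticeMap k p ∈ s → latticeMap k q ∈ s → p ≤ q ∨ q ≤ p := by
    intro p q hp hq
    by_contra! h
    have := energy_inf_add_sup_lt c.ofLp h.1 h.2
    linarith [hmin p (p ⊓ q) hp, hmin q (p ⊔ q) hq]
  intro u hu w hw
  obtain ⟨p, rfl⟩ := latticeMap_surjective hk u
  obtain ⟨q, rfl⟩ := latticeMap_surjective hk w
  obtain ⟨i, -, hi⟩ := Finset.exists_max_image Finset.univ (fun i => p i - q i)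
    ⟨⟨0, Nat.pos_of_ne_zero hk⟩, Finset.mem_univ _⟩
  -- The lift `q + t` of the second point is the lowest one above `p`, so it is below `p + 1`.
  set t := p i - q i with ht
  have hshift : ∀ t : ℤ, latticeMap k (fun i => q i + t) = latticeMap k q := fun t =>
    (latticeMap_eq_iff _ _).2 ⟨t, fun _ => rfl⟩
  have hup : ∀ j, q j + (t - 1) ≤ p j := by
    rcases hcomp p (fun j => q j + (t - 1)) hu (by rwa [hshift]) with h | h
    · have : p i ≤ q i + (t - 1) := h i
      omega
    · exact h
  have hlo : ∀ j, p j - q j ≤ t := fun j => hi j (Finset.mem_univ j)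
  refine ⟨Finset.univ.filter fun j => p j < q j + t, fun h => ?_, ?_⟩
  · have := (Finset.mem_filter.1 (h ▸ Finset.mem_univ i)).2
    omega
  · rw [subsetVec, ← map_add, ← hshift t]
    congr 1
    ext j
    have h1 := hup j
    have h2 := hlo j
    simp only [indicatorVec, Finset.mem_filter, Finset.mem_univ, true_and, Pi.add_apply]
    split_ifs <;> omega

/-- The offset from a lattice point to the centre of the empty ball attached to a ranking `r` of the
indices. With this offset the energy becomes a sum of nonnegative terms over pairs of indices. -/
noncomputable def rankOffset {k : ℕ} (r : Fin k → ℕ) (i : Fin k) : ℝ :=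
  2⁻¹ * ∑ j, ((SignType.sign ((r j : ℤ) - r i) : ℤ) : ℝ)

lemma sign_sub_antisymm (a b : ℤ) :
    (SignType.sign (a - b) : ℤ) = -(SignType.sign (b - a) : ℤ) := by
  rw [← neg_sub b a, Left.sign_neg]
  simp

lemma sum_rankOffset {k : ℕ} (r : Fin k → ℕ) : ∑ i, rankOffset r i = 0 := by
  have h : ∑ i, ∑ j, ((SignType.sign ((r j : ℤ) - r i) : ℤ) : ℝ)
      = -∑ i, ∑ j, ((SignType.sign ((r j : ℤ) - r i) : ℤ) : ℝ) := by
    conv_lhs => rw [Finset.sum_comm]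
    simp only [← Finset.sum_neg_distrib]
    refine Finset.sum_congr rfl fun i _ => Finset.sum_congr rfl fun j _ => ?_
    rw [sign_sub_antisymm]
    push_cast
    ring
  simp only [rankOffset, ← Finset.mul_sum]
  linarith

/-- The contribution of an ordered pair of indices to twice the energy for a rank offset. It is
nonnegative because `x ^ 2 - s * x ≥ 0` for integers `x` and `s ∈ {-1, 0, 1}`; for `r i < r j` it
vanishes only if `d i - d j ∈ {0, 1}`, and for `r i = r j` only if `d i = d j`. -/
noncomputable def pairEnergy {k : ℕ} (r : Fin k → ℕ) (d : Fin k → ℤ) (i j : Fin k) : ℤ :=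
  (d i - d j) ^ 2 - SignType.sign ((r j : ℤ) - r i) * (d i - d j)

lemma pairEnergy_nonneg {k : ℕ} (r : Fin k → ℕ) (d : Fin k → ℤ) (i j : Fin k) :
    0 ≤ pairEnergy r d i j := by
  unfold pairEnergy
  generalize d i - d j = x
  rcases lt_trichotomy x 0 with h | h | h <;>
    rcases SignType.sign ((r j : ℤ) - r i) with _ | _ | _ <;> simp <;> nlinarith

lemma energy_rankOffset {k : ℕ} (r : Fin k → ℕ) (d : Fin k → ℤ) :
    energy (rankOffset r) d = 2⁻¹ * ∑ i, ∑ j, (pairEnergy r d i j : ℝ) := by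
  have hs : ∑ i, ∑ j, ((SignType.sign ((r j : ℤ) - r i) : ℤ) : ℝ) * d j
      = -∑ i, ∑ j, ((SignType.sign ((r j : ℤ) - r i) : ℤ) : ℝ) * d i := by
    conv_lhs => rw [Finset.sum_comm]
    simp only [← Finset.sum_neg_distrib]
    refine Finset.sum_congr rfl fun i _ => Finset.sum_congr rfl fun j _ => ?_
    rw [sign_sub_antisymm]
    push_cast
    ring
  have he : ∑ i, (d i : ℝ) * rankOffset r i
      = 2⁻¹ * ∑ i, ∑ j, ((SignType.sign ((r j : ℤ) - r i) : ℤ) : ℝ) * d i := by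
    simp only [rankOffset, Finset.mul_sum]
    refine Finset.sum_congr rfl fun i _ => Finset.sum_congr rfl fun j _ => ?_
    ring
  have hp : ∀ i j, (pairEnergy r d i j : ℝ) = (d i : ℝ) ^ 2 - 2 * (d i * d j) + (d j : ℝ) ^ 2
      - ((SignType.sign ((r j : ℤ) - r i) : ℤ) : ℝ) * d i
      + ((SignType.sign ((r j : ℤ) - r i) : ℤ) : ℝ) * d j := fun i j => by
    unfold pairEnergy
    push_cast
    ring
  simp only [hp, Finset.sum_add_distrib, Finset.sum_sub_distrib, hs, energy, he,
    ← Finset.mul_sum, ← Finset.sum_mul, Finset.sum_const, Finset.card_univ, Fintype.card_fin,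
    nsmul_eq_mul]
  ring

/-- For a member `z` of a clique `t`, the lattice points of minimal energy for the ranking given by
the chain of `t` at `z` are precisely the members of `t`. -/
lemma IsLatticeClique.mem_iff_pairEnergy {k : ℕ} (hk : k ≠ 0) {t : Finset (permLattice k)}
    (ht : IsLatticeClique t) {z : permLattice k} (hz : z ∈ t) (d : Fin k → ℤ) :
    z + latticeMap k d ∈ t ↔ ∀ i j, pairEnergy (chainRank (linkSets t z)) d i j = 0 := by
  have hC := ht.isSetChain z
  have h0 : ∅ ∈ linkSets t z := mem_linkSets.2
    ⟨(Finset.univ_nonempty_iff.2 ⟨⟨0, Nat.pos_of_ne_zero hk⟩⟩).ne_empty.symm, by simpa using hz⟩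
  constructor
  · intro h
    obtain ⟨A, hA, hd⟩ := ht z hz _ h
    have hAC : A ∈ linkSets t z := mem_linkSets.2 ⟨hA, hd ▸ h⟩
    obtain ⟨m, hm⟩ := (latticeMap_eq_iff _ _).1 (add_left_cancel hd)
    intro i j
    simp only [pairEnergy, hm, indicatorVec]
    by_cases hi : i ∈ A <;> by_cases hj : j ∈ A
    · simp [hi, hj]
    · have := hC.chainRank_lt hAC hi hj
      rw [sign_pos (by omega)]
      simp [hi, hj]
    · have := hC.chainRank_lt hAC hj hi
      rw [sign_neg (by omega)]
      simp [hi, hj]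
    · simp [hi, hj]
  · intro h
    obtain ⟨j₀, -, hj₀⟩ := Finset.exists_min_image Finset.univ d
      ⟨⟨0, Nat.pos_of_ne_zero hk⟩, Finset.mem_univ _⟩
    -- Relative to its minimum, `d` is the indicator vector of a lower set for the rank.
    have hstep : ∀ i j, d j < d i →
        d i = d j + 1 ∧ chainRank (linkSets t z) i < chainRank (linkSets t z) j := by
      intro i j hij
      have := h i j
      unfold pairEnergy at this
      rcases lt_trichotomy ((chainRank (linkSets t z) j : ℤ) - chainRank (linkSets t z) i) 0
        with hr | hr | hr
      · rw [sign_neg hr] at this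
        simp at this
        nlinarith
      · rw [hr] at this
        simp at this
        omega
      · rw [sign_pos hr] at this
        refine ⟨?_, by omega⟩
        have h2 : (d i - d j) * (d i - d j - 1) = 0 := by
          simp at this
          linarith
        rcases mul_eq_zero.1 h2 with h3 | h3 <;> omega
    have hA : (Finset.univ.filter fun i => d j₀ < d i) ∈ linkSets t z := by
      refine hC.mem_of_lower h0 (fun h => ?_) fun i hi j hj => (hstep i j ?_).2
      · have := h.symm ▸ Finset.mem_univ j₀
        exact lt_irrefl _ (Finset.mem_filter.1 this).2
      · simp only [Finset.mem_filter, Finset.mem_univ, true_and] at hi hj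
        omega
    have hd : latticeMap k d = subsetVec (Finset.univ.filter fun i => d j₀ < d i) := by
      refine (latticeMap_eq_iff _ _).2 ⟨d j₀, fun i => ?_⟩
      have h1 := hj₀ i (Finset.mem_univ i)
      simp only [indicatorVec, Finset.mem_filter, Finset.mem_univ, true_and]
      split_ifs with h2
      · rw [(hstep i j₀ h2).1]
        ring
      · omega
    rw [hd]
    exact (mem_linkSets.1 hA).2

lemma latticePoint_add {k : ℕ} (z w : permLattice k) :
    latticePoint (z + w) = latticePoint z + latticePoint w := by
  ext i
  simp [latticePoint]

/-- A nonempty clique is exactly the set of lattice points on the sphere of an empty ball, whose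
centre is displaced from a member of the clique by the rank offset of its chain. -/
lemma IsLatticeClique.isDeloneCell {k : ℕ} (hk : k ≠ 0) {t : Finset (permLattice k)}
    (ht : IsLatticeClique t) (hne : t.Nonempty) : IsDeloneCell t := by
  obtain ⟨z, hz⟩ := hne
  set r := chainRank (linkSets t z)
  set e : EuclideanSpace ℝ (Fin k) := WithLp.toLp 2 (rankOffset r) with he
  have heH : e ∈ hyperplane k := sum_rankOffset r
  have hkpos : (0 : ℝ) < k := by exact_mod_cast Nat.pos_of_ne_zero hk
  have hdist : ∀ d : Fin k → ℤ, dist (latticePoint (z + latticeMap k d)) (latticePoint z + e) ^ 2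
      = k * (2⁻¹ * ∑ i, ∑ j, (pairEnergy r d i j : ℝ)) + ∑ i, e i ^ 2 := fun d => by
    rw [latticePoint_add, dist_add_left, dist_sq_latticeMap heH, ← energy_rankOffset]
  have hnn : ∀ d i j, (0 : ℝ) ≤ pairEnergy r d i j := fun d i j => by
    exact_mod_cast pairEnergy_nonneg r d i j
  have hsn : ∀ d, (0 : ℝ) ≤ ∑ i, ∑ j, (pairEnergy r d i j : ℝ) := fun d =>
    Finset.sum_nonneg fun i _ => Finset.sum_nonneg fun j _ => hnn d i j
  have hsurj : ∀ w, ∃ d, z + latticeMap k d = w := fun w => by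
    obtain ⟨d, hd⟩ := latticeMap_surjective hk (w - z)
    exact ⟨d, by rw [hd]; abel⟩
  have hsq : 0 ≤ ∑ i, e i ^ 2 := Finset.sum_nonneg fun i _ => sq_nonneg _
  refine ⟨⟨z, hz⟩, latticePoint z + e, ?_, √(∑ i, e i ^ 2), fun w => ?_, fun w => ?_⟩
  · have hz0 : ∑ i, ((z : Fin k → ℤ) i : ℝ) = 0 := by exact_mod_cast z.2.1
    have he0 : ∑ i, e i = 0 := heH
    change ∑ i, (latticePoint z + e) i = 0
    simp only [PiLp.add_apply, Finset.sum_add_distrib, he0, add_zero]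
    exact hz0
  · obtain ⟨d, rfl⟩ := hsurj w
    refine Real.sqrt_le_iff.2 ⟨dist_nonneg, ?_⟩
    rw [hdist]
    have := mul_nonneg hkpos.le (hsn d)
    linarith
  · obtain ⟨d, rfl⟩ := hsurj w
    rw [ht.mem_iff_pairEnergy hk hz, eq_comm, Real.sqrt_eq_iff_eq_sq hsq dist_nonneg, hdist]
    have h1 : (∑ i, ∑ j, (pairEnergy r d i j : ℝ) = 0) ↔ ∀ i j, pairEnergy r d i j = 0 := by
      rw [Finset.sum_eq_zero_iff_of_nonneg fun i _ => Finset.sum_nonneg fun j _ => hnn d i j]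
      simp only [Finset.sum_eq_zero_iff_of_nonneg fun j _ => hnn d _ j, Finset.mem_univ,
        true_imp_iff, Int.cast_eq_zero]
    rw [← h1]
    constructor
    · intro h
      rw [h]
      ring
    · intro h
      have : (k : ℝ) * (2⁻¹ * ∑ i, ∑ j, (pairEnergy r d i j : ℝ)) = 0 := by linarith
      simpa [hkpos.ne'] using this

/-- The simplices of the Delone complex are the nonempty cliques. -/
lemma mem_deloneComplex_iff {k : ℕ} (hk : k ≠ 0) {t : Finset (permLattice k)} :
    t ∈ (deloneComplex k).faces ↔ t.Nonempty ∧ IsLatticeClique t := by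
  constructor
  · rintro ⟨hne, s, hs, hts⟩
    exact ⟨hne, fun u hu w hw => hs.isLatticeClique hk u (hts hu) w (hts hw)⟩
  · rintro ⟨hne, ht⟩
    exact ⟨hne, t, ht.isDeloneCell hk hne, Finset.Subset.refl t⟩

/-! ### Vertices of the universal cover and their extensions along edges -/

section Cover

variable {V : Type*} [DecidableEq V] {K : PreAbstractSimplicialComplex V}

lemma ElementaryMove.append {a b c : V} {α β : EdgePath K a b} (h : ElementaryMove K α β)
    (γ : EdgePath K b c) : ElementaryMove K (α.append γ) (β.append γ) := by
  cases h with
  | triangle α hxy hyz hxz ht β =>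
    simp only [← SimpleGraph.Walk.append_assoc, SimpleGraph.Walk.cons_append]
    exact .triangle α hxy hyz hxz ht _
  | backtrack α hxy β =>
    simp only [← SimpleGraph.Walk.append_assoc, SimpleGraph.Walk.cons_append]
    exact .backtrack α hxy _

lemma Homotopic.append {a b c : V} {α β : EdgePath K a b} (h : Homotopic α β)
    (γ : EdgePath K b c) : Homotopic (α.append γ) (β.append γ) := by
  induction h with
  | rel _ _ h => exact .rel _ _ (h.append γ)
  | refl _ => exact .refl _
  | symm _ _ _ ih => exact .symm _ _ ih
  | trans _ _ _ _ _ ih₁ ih₂ => exact .trans _ _ _ ih₁ ih₂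

lemma Homotopic.concat {a b c : V} {α β : EdgePath K a b} (h : Homotopic α β)
    (e : (edgeGraph K).Adj b c) : Homotopic (α.concat e) (β.concat e) := by
  rw [SimpleGraph.Walk.concat_eq_append, SimpleGraph.Walk.concat_eq_append]
  exact h.append _

lemma homotopic_concat_concat_of_triangle {a x y z : V} (α : EdgePath K a x)
    (hxy : (edgeGraph K).Adj x y) (hyz : (edgeGraph K).Adj y z) (hxz : (edgeGraph K).Adj x z)
    (ht : ({x, y, z} : Finset V) ∈ K.faces) :
    Homotopic ((α.concat hxy).concat hyz) (α.concat hxz) := by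
  have := ElementaryMove.triangle α hxy hyz hxz ht .nil
  refine .rel _ _ ?_
  rwa [SimpleGraph.Walk.concat_eq_append, SimpleGraph.Walk.concat_append,
    SimpleGraph.Walk.concat_eq_append]

lemma homotopic_concat_concat_symm {a x y : V} (α : EdgePath K a x)
    (h : (edgeGraph K).Adj x y) : Homotopic ((α.concat h).concat h.symm) α := by
  have := ElementaryMove.backtrack α h .nil
  refine .rel _ _ ?_
  rwa [SimpleGraph.Walk.append_nil, ← SimpleGraph.Walk.concat_append,
    ← SimpleGraph.Walk.concat_eq_append] at this

lemma homotopic_append_reverse {a b : V} (α : EdgePath K a b) :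
    Homotopic (α.append α.reverse) .nil := by
  induction α using SimpleGraph.Walk.concatRec with
  | Hnil => exact .refl _
  | Hconcat α h ih =>
    refine .trans _ _ _ (.rel _ _ ?_) ih
    have := ElementaryMove.backtrack α h α.reverse
    rwa [SimpleGraph.Walk.reverse_concat, SimpleGraph.Walk.concat_append]

/-- The vertex of the universal cover obtained by adding an edge at the end of an edge-path. -/
def CoverVertex.extend {v₀ : V} (v : CoverVertex K v₀) (y : V)
    (h : (edgeGraph K).Adj v.endpoint y) : CoverVertex K v₀ :=
  ⟨y, Quotient.map (fun α : EdgePath K v₀ v.1 => α.concat h)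
    (fun α β (hαβ : Homotopic α β) => by
      exact hαβ.concat h) v.2⟩

lemma CoverVertex.exists_mk {v₀ : V} (v : CoverVertex K v₀) :
    ∃ (x : V) (α : EdgePath K v₀ x), CoverVertex.mk α = v := by
  obtain ⟨x, q⟩ := v
  induction q using Quotient.ind with
  | _ α => exact ⟨x, α, rfl⟩

lemma CoverVertex.mk_eq_iff {v₀ x : V} {α β : EdgePath K v₀ x} :
    CoverVertex.mk α = CoverVertex.mk β ↔ Homotopic α β := by
  constructor
  · intro h
    exact Quotient.exact (eq_of_heq (Sigma.mk.inj h).2)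
  · intro h
    exact congrArg (Sigma.mk x) (Quotient.sound h)

lemma CoverVertex.extend_extend_of_triangle {v₀ : V} (v : CoverVertex K v₀) {y z : V}
    (hxy : (edgeGraph K).Adj v.endpoint y) (hyz : (edgeGraph K).Adj y z)
    (hxz : (edgeGraph K).Adj v.endpoint z) (ht : ({v.endpoint, y, z} : Finset V) ∈ K.faces) :
    (v.extend y hxy).extend z hyz = v.extend z hxz := by
  obtain ⟨x, α, rfl⟩ := v.exists_mk
  exact mk_eq_iff.2 (homotopic_concat_concat_of_triangle α hxy hyz hxz ht)

lemma CoverVertex.extend_congr {v₀ : V} (v : CoverVertex K v₀) {y z : V} (h : y = z)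
    (hy : (edgeGraph K).Adj v.endpoint y) (hz : (edgeGraph K).Adj v.endpoint z) :
    v.extend y hy = v.extend z hz := by
  subst h
  rfl

lemma CoverVertex.extend_extend_of_eq {v₀ : V} (v : CoverVertex K v₀) {y z : V}
    (hy : (edgeGraph K).Adj v.endpoint y) (hz : (edgeGraph K).Adj y z) (h : z = v.endpoint) :
    (v.extend y hy).extend z hz = v := by
  subst h
  obtain ⟨x, α, rfl⟩ := v.exists_mk
  exact mk_eq_iff.2 (homotopic_concat_concat_symm α hy)

lemma CoverVertex.neighbors_extend {v₀ : V} (v : CoverVertex K v₀) {y : V}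
    (h : (edgeGraph K).Adj v.endpoint y) : v.Neighbors (v.extend y h) := by
  obtain ⟨x, α, rfl⟩ := v.exists_mk
  exact ⟨x, y, α, α.concat h, rfl, rfl, h, homotopic_append_reverse _⟩

end Cover

namespace LengthVector

variable {n k : ℕ} (L : LengthVector n k)

/-! ### Edges and simplices of the Tonnetz -/

/-- The displacement in `ℤ/n` along an edge of type `I`. -/
def shift (I : Finset (Fin k)) : ZMod n := ((∑ i ∈ I, L.len i : ℕ) : ZMod n)

@[simp] lemma shift_empty : L.shift ∅ = 0 := by simp [shift]

@[simp] lemma shift_univ : L.shift Finset.univ = 0 := by simp [shift, L.sum_len]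

lemma shift_singleton (i : Fin k) : L.shift {i} = L.len i := by simp [shift]

lemma shift_union {I J : Finset (Fin k)} (h : Disjoint I J) :
    L.shift (I ∪ J) = L.shift I + L.shift J := by
  simp [shift, Finset.sum_union h]

lemma sum_len_lt {I : Finset (Fin k)} (hI : I ≠ Finset.univ) : ∑ i ∈ I, L.len i < n := by
  obtain ⟨j, hj⟩ : ∃ j, j ∉ I := by simpa [Finset.eq_univ_iff_forall] using hI
  calc ∑ i ∈ I, L.len i < ∑ i, L.len i :=
        Finset.sum_lt_sum_of_subset (Finset.subset_univ I) (Finset.mem_univ j) hj (L.len_pos j)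
          fun i _ _ => Nat.zero_le _
    _ = n := L.sum_len

lemma val_shift {I : Finset (Fin k)} (hI : I ≠ Finset.univ) :
    (L.shift I).val = ∑ i ∈ I, L.len i := by
  rw [shift, ZMod.val_natCast, Nat.mod_eq_of_lt (L.sum_len_lt hI)]

lemma shift_ne_zero {I : Finset (Fin k)} (hI : I ≠ Finset.univ) (hne : I.Nonempty) :
    L.shift I ≠ 0 := by
  intro h
  have h1 := L.val_shift hI
  rw [h, ZMod.val_zero] at h1
  exact (Finset.sum_pos (fun i _ => L.len_pos i) hne).ne h1

lemma edgeType_add_shift (hgen : L.Generic) (u : ZMod n) {I : Finset (Fin k)}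
    (hI : I ≠ Finset.univ) : L.edgeType u (u + L.shift I) = I := by
  have h : ∃ J : Finset (Fin k), ∑ i ∈ J, L.len i = (u + L.shift I - u).val :=
    ⟨I, by rw [add_sub_cancel_left, L.val_shift hI]⟩
  rw [edgeType, dif_pos h]
  apply hgen
  rw [h.choose_spec, add_sub_cancel_left, L.val_shift hI]

/-- The vertices `x + l_A` of the Tonnetz, where `A` runs through a chain of proper subsets of
`[k]`, span a simplex, and every simplex arises in this way. -/
lemma mem_tonnetz_iff {s : Finset (ZMod n)} :
    s ∈ L.tonnetz.faces ↔ s.Nonempty ∧ ∃ (x : ZMod n) (C : Finset (Finset (Fin k))),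
      IsSetChain C ∧ Finset.univ ∉ C ∧ ∀ u ∈ s, ∃ A ∈ C, u = x + L.shift A := by
  have hsum : ∀ (σ : Equiv.Perm (Fin k)) (j : Fin k),
      L.shift ((Finset.Iio j).map σ.toEmbedding)
        = ∑ i ∈ Finset.Iio j, (L.len (σ i) : ZMod n) := fun σ j => by simp [shift]
  constructor
  · rintro ⟨hs, x, σ, h⟩
    refine ⟨hs, x, Finset.univ.image fun j => (Finset.Iio j).map σ.toEmbedding, ?_, ?_, ?_⟩
    · intro A hA B hB
      simp only [Finset.mem_image, Finset.mem_univ, true_and] at hA hB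
      obtain ⟨i, rfl⟩ := hA
      obtain ⟨j, rfl⟩ := hB
      rw [Finset.map_subset_map, Finset.map_subset_map]
      exact (le_total i j).imp Finset.Iio_subset_Iio Finset.Iio_subset_Iio
    · intro hmem
      obtain ⟨j, -, hj⟩ := Finset.mem_image.1 hmem
      have : σ j ∈ (Finset.Iio j).map σ.toEmbedding := hj ▸ Finset.mem_univ _
      simp at this
    · intro u hu
      obtain ⟨j, -, hj⟩ := Finset.mem_image.1 (h hu)
      exact ⟨_, Finset.mem_image_of_mem _ (Finset.mem_univ j), by rw [hsum, ← hj]⟩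
  · rintro ⟨hs, x, C, hC, huniv, h⟩
    -- Sorting the indices by rank turns the members of the chain into initial segments.
    set σ := Tuple.sort (chainRank C)
    have hmono : Monotone (chainRank C ∘ σ) := Tuple.monotone_sort _
    refine ⟨hs, x, σ, fun u hu => ?_⟩
    obtain ⟨A, hA, rfl⟩ := h u hu
    obtain ⟨j₁, hj₁⟩ : ∃ j, j ∉ A := by
      have : A ≠ Finset.univ := fun h => huniv (h ▸ hA)
      simpa [Finset.eq_univ_iff_forall] using this
    obtain ⟨j, hj, hmin⟩ := Finset.exists_min_image (Finset.univ.filter fun j => σ j ∉ A) id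
      ⟨σ.symm j₁, by simpa using hj₁⟩
    simp only [Finset.mem_filter, Finset.mem_univ, true_and, id] at hj hmin
    have hAj : A = (Finset.Iio j).map σ.toEmbedding := by
      ext i
      simp only [Finset.mem_map_equiv, Finset.mem_Iio]
      constructor
      · intro hi
        by_contra hji
        have h1 := hmono (not_lt.1 hji)
        have h2 := hC.chainRank_lt hA hi hj
        simp only [Function.comp_apply, Equiv.apply_symm_apply] at h1
        omega
      · intro hi
        by_contra hiA
        exact absurd (hmin (σ.symm i) (by simpa using hiA)) (not_le.2 hi)
    exact Finset.mem_image.2 ⟨j, Finset.mem_univ _, by rw [hAj, hsum]⟩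

/-- The edge joining two vertices `x + l_A` and `x + l_B` of a simplex is of type `B \ A` or
`[k] \ (A \ B)`. -/
lemma exists_difference {A B : Finset (Fin k)} (hB : B ≠ Finset.univ) (h : A ⊆ B ∨ B ⊆ A) :
    ∃ I : Finset (Fin k), I ≠ Finset.univ ∧ subsetVec I = subsetVec B - subsetVec A ∧
      L.shift B = L.shift A + L.shift I := by
  by_cases hAB : A ⊆ B
  · refine ⟨B \ A, fun hu => hB (Finset.univ_subset_iff.1 (hu ▸ Finset.sdiff_subset)), ?_, ?_⟩
    · rw [eq_sub_iff_add_eq', ← subsetVec_union Finset.disjoint_sdiff,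
        Finset.union_sdiff_of_subset hAB]
    · rw [← shift_union _ Finset.disjoint_sdiff, Finset.union_sdiff_of_subset hAB]
  · have hBA : B ⊆ A := h.resolve_left hAB
    have hd : Disjoint B (A \ B) := Finset.disjoint_sdiff
    have hu : B ∪ A \ B = A := Finset.union_sdiff_of_subset hBA
    have hd' : Disjoint (A \ B) (A \ B)ᶜ := disjoint_compl_right
    have hu' : (A \ B) ∪ (A \ B)ᶜ = Finset.univ := Finset.union_compl _
    refine ⟨(A \ B)ᶜ, ?_, ?_, ?_⟩
    · rw [Ne, Finset.compl_eq_univ_iff, Finset.sdiff_eq_empty_iff_subset]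
      exact hAB
    · have h1 := subsetVec_union hd
      have h2 := subsetVec_union hd'
      rw [hu] at h1
      rw [hu', subsetVec_univ] at h2
      rw [h1, eq_neg_of_add_eq_zero_right h2.symm]
      abel
    · have h1 := L.shift_union hd
      have h2 := L.shift_union hd'
      rw [hu] at h1
      rw [hu', shift_univ] at h2
      rw [h1, add_assoc, ← h2, add_zero]

lemma adj_add_shift (u : ZMod n) {I : Finset (Fin k)} (hI : I ≠ Finset.univ)
    (hne : I.Nonempty) : (edgeGraph L.tonnetz).Adj u (u + L.shift I) := by
  refine ⟨fun h => L.shift_ne_zero hI hne (by simpa using h), L.mem_tonnetz_iff.2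
    ⟨⟨u, by simp⟩, u, {∅, I}, ?_, ?_, ?_⟩⟩
  · simp [IsSetChain]
  · have := hne.ne_empty
    simp only [Finset.mem_insert, Finset.mem_singleton, not_or]
    refine ⟨fun h => ?_, hI.symm⟩
    exact this (Finset.subset_empty.1 (h ▸ Finset.subset_univ I))
  · simp

lemma triangle_add_shift (u : ZMod n) {I J : Finset (Fin k)} (hIJ : I ⊆ J)
    (hJ : J ≠ Finset.univ) :
    ({u, u + L.shift I, u + L.shift J} : Finset (ZMod n)) ∈ L.tonnetz.faces := by
  refine L.mem_tonnetz_iff.2 ⟨⟨u, by simp⟩, u, {∅, I, J}, ?_, ?_, ?_⟩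
  · simp [IsSetChain, hIJ]
  · simp only [Finset.mem_insert, Finset.mem_singleton, not_or]
    refine ⟨fun h => ?_, fun h => ?_, hJ.symm⟩
    · exact hJ (Finset.univ_subset_iff.1 (h ▸ Finset.empty_subset J))
    · exact hJ (Finset.univ_subset_iff.1 (h ▸ hIJ))
  · simp

/-- Every oriented edge has a type, which is a nonempty proper subset of `[k]`. -/
lemma exists_shift_of_adj {u v : ZMod n} (h : (edgeGraph L.tonnetz).Adj u v) :
    ∃ I : Finset (Fin k), I ≠ Finset.univ ∧ I.Nonempty ∧ v = u + L.shift I := by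
  obtain ⟨-, x, C, hC, huniv, hs⟩ := L.mem_tonnetz_iff.1 h.2
  obtain ⟨A, hA, hu⟩ := hs u (by simp)
  obtain ⟨B, hB, hv⟩ := hs v (by simp)
  obtain ⟨I, hI, -, hsh⟩ := L.exists_difference (fun h => huniv (h ▸ hB)) (hC A hA B hB)
  have huv : v = u + L.shift I := by rw [hu, hv, hsh, add_assoc]
  refine ⟨I, hI, Finset.nonempty_iff_ne_empty.2 ?_, huv⟩
  rintro rfl
  exact h.1 (by simpa using huv.symm)

/-! ### The canonical cocycle as a lattice vector -/

/-- The value of the canonical cocycle on an oriented edge, as an element of `Λ`. -/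
noncomputable def edgeVec (u v : ZMod n) : permLattice k := subsetVec (L.edgeType u v)

lemma coe_edgeVec (u v : ZMod n) : (L.edgeVec u v : Fin k → ℤ) = L.omegaEdge u v := by
  ext i
  have hsum : ∀ m : Fin k, ∑ j ∈ Finset.univ.erase i,
      (((if m = i then 1 else 0) - (if m = j then 1 else 0)) : ℤ) = latticeVector k m i := by
    intro m
    rw [Finset.sum_erase_eq_sub (Finset.mem_univ i), Finset.sum_sub_distrib, latticeVector]
    by_cases hm : m = i
    · simp [hm]
    · simp [hm, Ne.symm hm]
  simp only [edgeVec, coe_subsetVec, omegaEdge, theta]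
  rw [Finset.sum_comm, Finset.sum_apply]
  exact Finset.sum_congr rfl fun m _ => (hsum m).symm

lemma edgeVec_add_shift (hgen : L.Generic) (u : ZMod n) {I : Finset (Fin k)}
    (hI : I ≠ Finset.univ) : L.edgeVec u (u + L.shift I) = subsetVec I := by
  rw [edgeVec, L.edgeType_add_shift hgen u hI]

/-- On a simplex with vertices `x + l_A` the cocycle is the coboundary of `A ↦ a_A`. -/
lemma edgeVec_of_comparable (hgen : L.Generic) (x : ZMod n) {A B : Finset (Fin k)}
    (hB : B ≠ Finset.univ) (h : A ⊆ B ∨ B ⊆ A) :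
    L.edgeVec (x + L.shift A) (x + L.shift B) = subsetVec B - subsetVec A := by
  obtain ⟨I, hI, hv, hs⟩ := L.exists_difference hB h
  rw [hs, ← add_assoc, L.edgeVec_add_shift hgen _ hI, hv]

lemma edgeVec_add_edgeVec (hgen : L.Generic) {u v w : ZMod n}
    (ht : ({u, v, w} : Finset (ZMod n)) ∈ L.tonnetz.faces) :
    L.edgeVec u v + L.edgeVec v w = L.edgeVec u w := by
  obtain ⟨-, x, C, hC, huniv, hs⟩ := L.mem_tonnetz_iff.1 ht
  obtain ⟨A, hA, rfl⟩ := hs u (by simp)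
  obtain ⟨B, hB, rfl⟩ := hs v (by simp)
  obtain ⟨D, hD, rfl⟩ := hs w (by simp)
  have hne : ∀ E ∈ C, E ≠ Finset.univ := fun E hE h => huniv (h ▸ hE)
  rw [L.edgeVec_of_comparable hgen x (hne B hB) (hC A hA B hB),
    L.edgeVec_of_comparable hgen x (hne D hD) (hC B hB D hD),
    L.edgeVec_of_comparable hgen x (hne D hD) (hC A hA D hD)]
  abel

/-- The value of the canonical cocycle on an edge-path, as an element of `Λ`. -/
noncomputable def pathVec {a b : ZMod n} (α : EdgePath L.tonnetz a b) : permLattice k :=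
  (α.darts.map fun d => L.edgeVec d.fst d.snd).sum

lemma coe_pathVec {a b : ZMod n} (α : EdgePath L.tonnetz a b) :
    (L.pathVec α : Fin k → ℤ) = L.omega α := by
  rw [pathVec, omega, ← AddSubgroup.subtype_apply, map_list_sum, List.map_map]
  congr 2
  funext d
  exact L.coe_edgeVec _ _

@[simp] lemma pathVec_nil {a : ZMod n} :
    L.pathVec (.nil : EdgePath L.tonnetz a a) = 0 := by simp [pathVec]

@[simp] lemma pathVec_cons {a b c : ZMod n} (h : (edgeGraph L.tonnetz).Adj a b)
    (α : EdgePath L.tonnetz b c) : L.pathVec (.cons h α) = L.edgeVec a b + L.pathVec α := by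
  simp [pathVec]

@[simp] lemma pathVec_append {a b c : ZMod n} (α : EdgePath L.tonnetz a b)
    (β : EdgePath L.tonnetz b c) : L.pathVec (α.append β) = L.pathVec α + L.pathVec β := by
  simp [pathVec]

@[simp] lemma pathVec_concat {a b c : ZMod n} (α : EdgePath L.tonnetz a b)
    (h : (edgeGraph L.tonnetz).Adj b c) :
    L.pathVec (α.concat h) = L.pathVec α + L.edgeVec b c := by
  simp [SimpleGraph.Walk.concat_eq_append]

lemma pathVec_eq_of_homotopic (hgen : L.Generic) {a b : ZMod n} {α β : EdgePath L.tonnetz a b}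
    (h : Homotopic α β) : L.pathVec α = L.pathVec β := by
  induction h with
  | rel _ _ h =>
    cases h with
    | triangle α hxy hyz hxz ht β =>
      simp only [pathVec_append, pathVec_cons]
      rw [← L.edgeVec_add_edgeVec hgen ht, add_assoc]
    | @backtrack x y α hxy β =>
      have h1 := L.edgeVec_add_edgeVec hgen (u := x) (v := y) (w := x)
        (by simpa [Finset.pair_comm] using hxy.2)
      have h2 : L.edgeVec x x = 0 := by
        obtain ⟨I, hI, -, -⟩ := L.exists_shift_of_adj hxy
        have hu : (∅ : Finset (Fin k)) ≠ Finset.univ := fun h =>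
          hI (Finset.univ_subset_iff.1 (h ▸ Finset.empty_subset I))
        simpa using L.edgeVec_add_shift hgen x hu
      rw [h2] at h1
      simp only [pathVec_append, pathVec_cons]
      rw [← add_assoc (L.edgeVec x y), h1, zero_add]
  | refl _ => rfl
  | symm _ _ _ ih => exact ih.symm
  | trans _ _ _ _ _ ih₁ ih₂ => exact ih₁.trans ih₂

/-- The discrete Abel–Jacobi map. -/
noncomputable def abelJacobi (hgen : L.Generic) {v₀ : ZMod n} (v : CoverVertex L.tonnetz v₀) :
    permLattice k :=
  Quotient.lift L.pathVec (fun _ _ h => L.pathVec_eq_of_homotopic hgen h) v.2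

lemma abelJacobi_mk (hgen : L.Generic) {v₀ x : ZMod n} (α : EdgePath L.tonnetz v₀ x) :
    L.abelJacobi hgen (CoverVertex.mk α) = L.pathVec α := rfl

lemma abelJacobi_extend (hgen : L.Generic) {v₀ y : ZMod n} (v : CoverVertex L.tonnetz v₀)
    (h : (edgeGraph L.tonnetz).Adj v.endpoint y) :
    L.abelJacobi hgen (v.extend y h) = L.abelJacobi hgen v + L.edgeVec v.endpoint y := by
  obtain ⟨x, α, rfl⟩ := v.exists_mk
  exact L.pathVec_concat α h

/-! ### The action of the atomic steps on the universal cover -/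

open Classical in
/-- Extension of the edge-paths representing a vertex of the universal cover by an edge of type
`I`. There is no such edge if `I` is empty or all of `[k]`, and then the vertex is unchanged. -/
noncomputable def advance {v₀ : ZMod n} (I : Finset (Fin k)) (v : CoverVertex L.tonnetz v₀) :
    CoverVertex L.tonnetz v₀ :=
  if h : (edgeGraph L.tonnetz).Adj v.endpoint (v.endpoint + L.shift I) then v.extend _ h else v

variable {v₀ : ZMod n}

lemma advance_of_adj {I : Finset (Fin k)} (v : CoverVertex L.tonnetz v₀)
    (h : (edgeGraph L.tonnetz).Adj v.endpoint (v.endpoint + L.shift I)) :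
    L.advance I v = v.extend _ h := dif_pos h

lemma advance_of_shift_eq_zero {I : Finset (Fin k)} (h : L.shift I = 0)
    (v : CoverVertex L.tonnetz v₀) : L.advance I v = v :=
  dif_neg fun hadj => hadj.1 (by rw [h, add_zero])

@[simp] lemma advance_empty (v : CoverVertex L.tonnetz v₀) : L.advance ∅ v = v :=
  L.advance_of_shift_eq_zero L.shift_empty v

@[simp] lemma advance_univ (v : CoverVertex L.tonnetz v₀) : L.advance Finset.univ v = v :=
  L.advance_of_shift_eq_zero L.shift_univ v

lemma endpoint_advance (I : Finset (Fin k)) (v : CoverVertex L.tonnetz v₀) :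
    (L.advance I v).endpoint = v.endpoint + L.shift I := by
  rcases I.eq_empty_or_nonempty with rfl | hne
  · simp
  by_cases hI : I = Finset.univ
  · simp [hI]
  rw [L.advance_of_adj v (L.adj_add_shift _ hI hne)]
  rfl

lemma abelJacobi_advance (hgen : L.Generic) (I : Finset (Fin k))
    (v : CoverVertex L.tonnetz v₀) :
    L.abelJacobi hgen (L.advance I v) = L.abelJacobi hgen v + subsetVec I := by
  rcases I.eq_empty_or_nonempty with rfl | hne
  · simp
  by_cases hI : I = Finset.univ
  · simp [hI]
  rw [L.advance_of_adj v (L.adj_add_shift _ hI hne), abelJacobi_extend,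
    L.edgeVec_add_shift hgen _ hI]

lemma exists_extend_eq_advance (v : CoverVertex L.tonnetz v₀) {y : ZMod n}
    (h : (edgeGraph L.tonnetz).Adj v.endpoint y) :
    ∃ I : Finset (Fin k), v.extend y h = L.advance I v := by
  obtain ⟨I, hI, hne, rfl⟩ := L.exists_shift_of_adj h
  exact ⟨I, (L.advance_of_adj v h).symm⟩

/-- Consecutive edges of disjoint types `I` and `J` compose to an edge of type `I ∪ J`, by a
triangle or, if `I ∪ J = [k]`, by a backtracking. -/
lemma advance_advance {I J : Finset (Fin k)} (hd : Disjoint I J)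
    (v : CoverVertex L.tonnetz v₀) : L.advance J (L.advance I v) = L.advance (I ∪ J) v := by
  rcases I.eq_empty_or_nonempty with rfl | hIne
  · simp
  rcases J.eq_empty_or_nonempty with rfl | hJne
  · simp
  have hI : I ≠ Finset.univ := by
    rintro rfl
    obtain ⟨j, hj⟩ := hJne
    exact Finset.disjoint_left.1 hd (Finset.mem_univ j) hj
  have hJ : J ≠ Finset.univ := by
    rintro rfl
    obtain ⟨i, hi⟩ := hIne
    exact Finset.disjoint_left.1 hd hi (Finset.mem_univ i)
  have hsh := L.shift_union hd
  have hadj := L.adj_add_shift v.endpoint hI hIne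
  have hadj' := L.adj_add_shift (v.endpoint + L.shift I) hJ hJne
  rw [L.advance_of_adj v hadj, L.advance_of_adj (v.extend _ hadj) hadj']
  by_cases hu : I ∪ J = Finset.univ
  · rw [hu, advance_univ]
    refine v.extend_extend_of_eq hadj hadj' ?_
    rw [add_assoc, ← hsh, hu, shift_univ, add_zero]
  · have hadj'' := L.adj_add_shift v.endpoint hu (hIne.mono Finset.subset_union_left)
    have heq : v.endpoint + L.shift I + L.shift J = v.endpoint + L.shift (I ∪ J) := by
      rw [hsh, add_assoc]
    rw [L.advance_of_adj v hadj'', ← v.extend_congr heq (heq ▸ hadj'') hadj'']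
    refine v.extend_extend_of_triangle hadj hadj' _ ?_
    rw [heq]
    exact L.triangle_add_shift _ Finset.subset_union_left hu

/-- The result of performing the atomic steps listed in a word, one after the other. -/
noncomputable def run (v : CoverVertex L.tonnetz v₀) (w : List (Fin k)) :
    CoverVertex L.tonnetz v₀ :=
  w.foldl (fun v i => L.advance {i} v) v

@[simp] lemma run_nil (v : CoverVertex L.tonnetz v₀) : L.run v [] = v := rfl

@[simp] lemma run_cons (v : CoverVertex L.tonnetz v₀) (i : Fin k) (w : List (Fin k)) :
    L.run v (i :: w) = L.run (L.advance {i} v) w := rfl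

lemma run_append (v : CoverVertex L.tonnetz v₀) (w w' : List (Fin k)) :
    L.run v (w ++ w') = L.run (L.run v w) w' := List.foldl_append

/-- Distinct atomic steps amount to a single edge whose type is the set of these steps. -/
lemma run_eq_advance (v : CoverVertex L.tonnetz v₀) {w : List (Fin k)} (hw : w.Nodup) :
    L.run v w = L.advance w.toFinset v := by
  induction w using List.reverseRecOn with
  | nil => simp
  | append_singleton w i ih =>
    rw [List.nodup_append] at hw
    have hd : Disjoint w.toFinset {i} := by
      rw [Finset.disjoint_singleton_right, List.mem_toFinset]
      exact fun h => hw.2.2 i h i (by simp) rfl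
    rw [run_append, ih hw.1, run_cons, run_nil, advance_advance _ hd, List.toFinset_append]
    simp

lemma run_perm (v : CoverVertex L.tonnetz v₀) {w w' : List (Fin k)} (h : w.Perm w') :
    L.run v w = L.run v w' := by
  have : RightCommutative fun (v : CoverVertex L.tonnetz v₀) (i : Fin k) =>
      L.advance {i} v := ⟨fun v i j => by
    rcases eq_or_ne i j with rfl | hij
    · rfl
    · have hd : Disjoint ({i} : Finset (Fin k)) {j} := by simpa using hij
      rw [L.advance_advance hd, L.advance_advance hd.symm, Finset.union_comm]⟩
  exact h.foldl_eq v

/-- The product of all atomic steps acts trivially. -/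
lemma run_replicate_finRange (v : CoverVertex L.tonnetz v₀) (t : ℕ) :
    L.run v (List.replicate t (List.finRange k)).flatten = v := by
  induction t with
  | zero => simp
  | succ t ih =>
    have : (List.finRange k).toFinset = Finset.univ := by ext; simp
    rw [List.replicate_succ, List.flatten_cons, run_append,
      run_eq_advance _ _ (List.nodup_finRange k), this, advance_univ, ih]

lemma abelJacobi_run (hgen : L.Generic) (v : CoverVertex L.tonnetz v₀) (w : List (Fin k)) :
    L.abelJacobi hgen (L.run v w)
      = L.abelJacobi hgen v + latticeMap k fun i => (w.count i : ℤ) := by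
  induction w generalizing v with
  | nil =>
    have : (fun i : Fin k => (([] : List (Fin k)).count i : ℤ)) = 0 := by ext; simp
    rw [this, map_zero, add_zero, run_nil]
  | cons j w ih =>
    rw [run_cons, ih, abelJacobi_advance, add_assoc, subsetVec, ← map_add]
    congr 2
    ext i
    by_cases h : i = j
    · subst h
      simp [indicatorVec, add_comm]
    · simp [indicatorVec, h, Ne.symm h]

/-- The result of a word depends only on the lattice vector of the word. -/
lemma run_eq_of_latticeMap_eq (v : CoverVertex L.tonnetz v₀) {w w' : List (Fin k)}
    (h : latticeMap k (fun i => (w.count i : ℤ)) = latticeMap k fun i => (w'.count i : ℤ)) :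
    L.run v w = L.run v w' := by
  -- The words differ, up to order, by copies of the trivially acting word `1 2 ⋯ k`.
  have key : ∀ (w w' : List (Fin k)) (t : ℕ), (∀ i, w.count i = w'.count i + t) →
      L.run v w = L.run v w' := by
    intro w w' t ht
    have hperm : w.Perm (w' ++ (List.replicate t (List.finRange k)).flatten) := by
      rw [List.perm_iff_count]
      intro i
      rw [List.count_append, List.count_flatten, List.map_replicate, List.sum_replicate,
        List.count_eq_one_of_mem (List.nodup_finRange k) (List.mem_finRange i), ht]
      simp
    rw [L.run_perm v hperm, run_append, run_replicate_finRange]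
  obtain ⟨t, ht⟩ := (latticeMap_eq_iff _ _).1 h
  rcases le_total 0 t with h0 | h0
  · exact key w w' t.toNat fun i => by have := ht i; omega
  · exact (key w' w (-t).toNat fun i => by have := ht i; omega).symm

lemma exists_run_eq (v : CoverVertex L.tonnetz v₀) :
    ∃ w, L.run (CoverVertex.mk .nil) w = v := by
  obtain ⟨x, α, rfl⟩ := v.exists_mk
  induction α using SimpleGraph.Walk.concatRec with
  | Hnil => exact ⟨[], rfl⟩
  | Hconcat α h ih =>
    obtain ⟨w, hw⟩ := ih
    obtain ⟨I, hI⟩ := L.exists_extend_eq_advance (CoverVertex.mk α) h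
    refine ⟨w ++ I.toList, ?_⟩
    rw [run_append, hw, run_eq_advance _ _ I.nodup_toList, Finset.toList_toFinset, ← hI]
    rfl

lemma abelJacobi_injective (hgen : L.Generic) :
    Function.Injective (L.abelJacobi hgen (v₀ := v₀)) := by
  intro v v' h
  obtain ⟨w, rfl⟩ := L.exists_run_eq v
  obtain ⟨w', rfl⟩ := L.exists_run_eq v'
  rw [abelJacobi_run, abelJacobi_run] at h
  exact L.run_eq_of_latticeMap_eq _ (add_left_cancel h)

/-! ### Monomial edge-paths -/

/-- The word `1^{p₁} 2^{p₂} ⋯ k^{p_k}`. -/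
def monomialWord (p : Fin k → ℕ) : List (Fin k) :=
  (List.finRange k).flatMap fun i => List.replicate (p i) i

lemma count_monomialWord (p : Fin k → ℕ) (i : Fin k) : (monomialWord p).count i = p i := by
  rw [monomialWord, List.count_flatMap, ← Fin.sum_univ_def]
  simp [List.count_replicate]

/-- An edge-path that performs the atomic steps of a word leads to the vertex of the universal cover
given by that word; the initial path `γ` makes the induction on the edge-path possible. -/
lemma mk_append_eq_run {a b : ZMod n} (γ : EdgePath L.tonnetz v₀ a) (α : EdgePath L.tonnetz a b)
    (w : List (Fin k))
    (h : α.support = List.scanl (fun x i => x + (L.len i : ZMod n)) a w) :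
    CoverVertex.mk (γ.append α) = L.run (CoverVertex.mk γ) w := by
  induction α generalizing w with
  | nil =>
    have hlen := congrArg List.length h
    rw [List.length_scanl] at hlen
    have : w = [] := by
      rw [← List.length_eq_zero_iff]
      simpa using hlen
    rw [this, run_nil, SimpleGraph.Walk.append_nil]
  | @cons u x c hux β ih =>
    cases w with
    | nil => simp at h
    | cons i w =>
      rw [SimpleGraph.Walk.support_cons, List.scanl_cons, List.cons.injEq] at h
      have hx : x = u + L.shift {i} := by
        have h1 := h.2
        rw [← SimpleGraph.Walk.cons_tail_support β] at h1
        rw [shift_singleton]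
        cases w <;> simp only [List.scanl_nil, List.scanl_cons, List.cons.injEq] at h1 <;>
          exact h1.1
      subst hx
      have hadv : L.advance {i} (CoverVertex.mk γ) = CoverVertex.mk (γ.concat hux) :=
        L.advance_of_adj (CoverVertex.mk γ) hux
      rw [run_cons, hadv, ← ih (γ.concat hux) w (by rw [h.2, shift_singleton]),
        SimpleGraph.Walk.concat_append]

lemma IsMonomialPath.mk_eq_run {p : Fin k → ℕ} {x : ZMod n} {α : EdgePath L.tonnetz v₀ x}
    (h : L.IsMonomialPath p α) :
    CoverVertex.mk α = L.run (CoverVertex.mk .nil) (monomialWord p) :=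
  L.mk_append_eq_run .nil α _ h

lemma exists_support_eq_scanl (hk : 2 ≤ k) (w : List (Fin k)) (a : ZMod n) :
    ∃ (b : ZMod n) (α : EdgePath L.tonnetz a b),
      α.support = List.scanl (fun x i => x + (L.len i : ZMod n)) a w := by
  induction w generalizing a with
  | nil => exact ⟨a, .nil, by simp⟩
  | cons i w ih =>
    obtain ⟨b, α, hα⟩ := ih (a + L.len i)
    have hI : ({i} : Finset (Fin k)) ≠ Finset.univ := by
      intro h
      have := congrArg Finset.card h
      simp at this
      omega
    have hadj := L.adj_add_shift a hI (Finset.singleton_nonempty i)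
    rw [shift_singleton] at hadj
    exact ⟨b, .cons hadj α, by rw [SimpleGraph.Walk.support_cons, hα, List.scanl_cons]⟩

/-- Every edge-path is homotopic to a word in the atomic steps, and these commute. For `k = 1` there
are no edges. -/
lemma exists_isMonomialPath_homotopic (hk : k ≠ 0) {x : ZMod n} (α : EdgePath L.tonnetz v₀ x) :
    ∃ (p : Fin k → ℕ) (β : EdgePath L.tonnetz v₀ x), L.IsMonomialPath p β ∧ Homotopic α β := by
  rcases (show k = 1 ∨ 2 ≤ k by omega) with rfl | hk2
  · cases α with
    | nil =>
      have h0 : monomialWord (0 : Fin 1 → ℕ) = [] := List.flatMap_eq_nil_iff.2 (by simp)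
      refine ⟨0, .nil, ?_, .refl _⟩
      change [v₀] = List.scanl _ v₀ (monomialWord 0)
      rw [h0, List.scanl_nil]
    | cons h α =>
      obtain ⟨I, hI, ⟨i, hi⟩, -⟩ := L.exists_shift_of_adj h
      exact absurd (Finset.eq_univ_iff_forall.2 fun j => Subsingleton.elim i j ▸ hi) hI
  · obtain ⟨w, hw⟩ := L.exists_run_eq (CoverVertex.mk α)
    let p : Fin k → ℕ := fun i => w.count i
    obtain ⟨y, β, hβ⟩ := L.exists_support_eq_scanl hk2 (monomialWord p) v₀
    have hmono : L.IsMonomialPath p β := hβ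
    have h : CoverVertex.mk α = CoverVertex.mk β := by
      rw [← hw, IsMonomialPath.mk_eq_run L hmono]
      exact L.run_perm _ (List.perm_iff_count.2 fun i => (count_monomialWord p i).symm)
    obtain rfl : x = y := congrArg CoverVertex.endpoint h
    exact ⟨p, β, hmono, CoverVertex.mk_eq_iff.1 h⟩

/-! ### The Abel–Jacobi map is a simplicial isomorphism -/

lemma abelJacobi_surjective (hgen : L.Generic) (hk : k ≠ 0) :
    Function.Surjective (L.abelJacobi hgen (v₀ := v₀)) := by
  intro z
  obtain ⟨q, rfl⟩ := latticeMap_surjective hk z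
  obtain ⟨j, -, hj⟩ := Finset.exists_min_image Finset.univ q
    ⟨⟨0, Nat.pos_of_ne_zero hk⟩, Finset.mem_univ _⟩
  refine ⟨L.run (CoverVertex.mk .nil) (monomialWord fun i => (q i - q j).toNat), ?_⟩
  rw [abelJacobi_run, abelJacobi_mk, pathVec_nil, zero_add]
  refine (latticeMap_eq_iff _ _).2 ⟨-q j, fun i => ?_⟩
  have := hj i (Finset.mem_univ i)
  rw [count_monomialWord]
  omega

lemma exists_abelJacobi_eq_of_neighbors (hgen : L.Generic) {v w : CoverVertex L.tonnetz v₀}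
    (h : v.Neighbors w) : ∃ I : Finset (Fin k), I ≠ Finset.univ ∧
      L.abelJacobi hgen w = L.abelJacobi hgen v + subsetVec I := by
  obtain ⟨x, y, α, β, rfl, rfl, e, h⟩ := h
  have h1 := L.pathVec_eq_of_homotopic hgen h
  have h2 := L.pathVec_eq_of_homotopic hgen (homotopic_append_reverse β)
  rw [← h2, pathVec_append, pathVec_append, pathVec_concat] at h1
  obtain ⟨I, hI, -, rfl⟩ := L.exists_shift_of_adj e
  refine ⟨I, hI, ?_⟩
  rw [abelJacobi_mk, abelJacobi_mk, ← add_right_cancel h1, L.edgeVec_add_shift hgen _ hI]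

lemma advance_eq_of_abelJacobi (hgen : L.Generic) {v w : CoverVertex L.tonnetz v₀}
    {I : Finset (Fin k)} (h : L.abelJacobi hgen w = L.abelJacobi hgen v + subsetVec I) :
    L.advance I v = w :=
  L.abelJacobi_injective hgen (by rw [abelJacobi_advance, h])

/-- Under the Abel–Jacobi map, neighbours in the universal cover correspond to lattice points that
differ by some `a_I`, and the simplices on both sides are the nonempty cliques. -/
lemma isSimplicialIso_abelJacobi (hgen : L.Generic) (hk : k ≠ 0) :
    IsSimplicialIso (universalCover L.tonnetz v₀) (deloneComplex k) (L.abelJacobi hgen) := by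
  refine ⟨⟨L.abelJacobi_injective hgen, L.abelJacobi_surjective hgen hk⟩, fun s => ?_⟩
  rw [mem_deloneComplex_iff hk, Finset.image_nonempty]
  constructor
  · rintro ⟨hne, -, hnb⟩
    refine ⟨hne, fun u hu w hw => ?_⟩
    obtain ⟨v, hv, rfl⟩ := Finset.mem_image.1 hu
    obtain ⟨v', hv', rfl⟩ := Finset.mem_image.1 hw
    by_cases hvv : v = v'
    · refine ⟨∅, ?_, by simp [hvv]⟩
      exact (Finset.univ_nonempty_iff.2 ⟨⟨0, Nat.pos_of_ne_zero hk⟩⟩).ne_empty.symm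
    · exact L.exists_abelJacobi_eq_of_neighbors hgen (hnb v hv v' hv' hvv)
  · rintro ⟨hne, hclique⟩
    refine ⟨hne, ?_, fun v hv w hw hvw => ?_⟩
    · obtain ⟨v, hv⟩ := hne
      refine L.mem_tonnetz_iff.2 ⟨⟨_, Finset.mem_image_of_mem _ hv⟩, v.endpoint,
        linkSets (s.image (L.abelJacobi hgen)) (L.abelJacobi hgen v), hclique.isSetChain _,
        fun h => (mem_linkSets.1 h).1 rfl, fun u hu => ?_⟩
      obtain ⟨w, hw, rfl⟩ := Finset.mem_image.1 hu
      have hw' := Finset.mem_image_of_mem (L.abelJacobi hgen) hw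
      obtain ⟨A, hA, h⟩ := hclique _ (Finset.mem_image_of_mem _ hv) _ hw'
      refine ⟨A, mem_linkSets.2 ⟨hA, h ▸ hw'⟩, ?_⟩
      rw [← L.endpoint_advance, L.advance_eq_of_abelJacobi hgen h]
    · obtain ⟨A, hA, h⟩ := hclique _ (Finset.mem_image_of_mem _ hv) _
        (Finset.mem_image_of_mem _ hw)
      have hadv := L.advance_eq_of_abelJacobi hgen h
      have hAne : A.Nonempty := Finset.nonempty_iff_ne_empty.2 (by
        rintro rfl
        exact hvw (by simpa using hadv))
      rw [← hadv, L.advance_of_adj v (L.adj_add_shift _ hA hAne)]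
      exact v.neighbors_extend _

end LengthVector

end Tonnetz

theorem mainTheorem3 (n k : ℕ) (L : Tonnetz.LengthVector n k) (hgen : L.Generic)
    (hred : L.Reduced) (v₀ : ZMod n) :
    -- the monomial edge-paths exist and represent all homotopy classes
    (2 ≤ k → ∀ p : Fin k → ℕ, ∃ (x : ZMod n) (α : Tonnetz.EdgePath L.tonnetz v₀ x),
      L.IsMonomialPath p α) ∧
    (∀ (x : ZMod n) (α : Tonnetz.EdgePath L.tonnetz v₀ x),
      ∃ (p : Fin k → ℕ) (β : Tonnetz.EdgePath L.tonnetz v₀ x),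
        L.IsMonomialPath p β ∧ Tonnetz.Homotopic α β) ∧
    -- every simplex of the Delone complex is itself a cell of the Delone decomposition
    (∀ s ∈ (Tonnetz.deloneComplex k).faces, Tonnetz.IsDeloneCell s) ∧
    -- the map induced by the canonical cocycle is well defined, is given by the formula on
    -- monomial edge-paths, and is a simplicial isomorphism
    ∃ Ω : Tonnetz.CoverVertex L.tonnetz v₀ → Tonnetz.permLattice k,
      (∀ (x : ZMod n) (α : Tonnetz.EdgePath L.tonnetz v₀ x),
        (Ω (Tonnetz.CoverVertex.mk α) : Fin k → ℤ) = L.omega α) ∧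
      (∀ (p : Fin k → ℕ) (x : ZMod n) (α : Tonnetz.EdgePath L.tonnetz v₀ x),
        L.IsMonomialPath p α →
          (Ω (Tonnetz.CoverVertex.mk α) : Fin k → ℤ) =
            ∑ i, p i • Tonnetz.latticeVector k i) ∧
      Tonnetz.IsSimplicialIso (Tonnetz.universalCover L.tonnetz v₀) (Tonnetz.deloneComplex k)
        Ω := by
  have hk : k ≠ 0 := by
    rintro rfl
    simp [Tonnetz.LengthVector.Reduced] at hred
  refine ⟨fun hk2 p => L.exists_support_eq_scanl hk2 (Tonnetz.LengthVector.monomialWord p) v₀,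
    fun x α => L.exists_isMonomialPath_homotopic hk α, fun s hs => ?_,
    L.abelJacobi hgen, fun x α => L.coe_pathVec α, fun p x α h => ?_,
    L.isSimplicialIso_abelJacobi hgen hk⟩
  · obtain ⟨hne, hc⟩ := (Tonnetz.mem_deloneComplex_iff hk).1 hs
    exact hc.isDeloneCell hk hne
  · rw [Tonnetz.LengthVector.IsMonomialPath.mk_eq_run L h, L.abelJacobi_run, L.abelJacobi_mk,
      L.pathVec_nil, zero_add, Tonnetz.coe_latticeMap]
    simp [Tonnetz.LengthVector.count_monomialWord]
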